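/- Let $q$ be a prime power, let $n,m$ be positive integers, and let $E=\mathbb{F}_q^n$. For $U\le E$ let $U^\perp$ denote the orthogonal complement of $U$ with respect to a fixed non-degenerate symmetric bilinear form on $E$. Let $C$ be an $\mathbb{F}_q$-$[n\times m,k,d]$ rank-metric code, that is, a $k$-dimensional $\mathbb{F}_q$-subspace of $\mathbb{F}_q^{n\times m}$ that has a nonzero member and in which $d$ is the minimum rank of a nonzero member. Let $C^\perp=\{Y\in\mathbb{F}_q^{n\times m} : \mathrm{Tr}(XY^T)=0 \text{ for all } X\in C\}$ be its dual code. For $U\le E$ put $C_{=U}=\{A\in C : \mathrm{col}(A)=U^\perp\}$, where $\mathrm{col}(A)$ is the column space of $A$. Let $t$ be a positive integer with $t<d$, and suppose that at most $d-t$ distinct elements of $\{1,\ldots,n-t\}$ occur as ranks of members of $C^\perp$. For each $i\in\{d,\ldots,n-t\}$ let $$B(i)=\{U\le E : \dim U=i,\ |C_{=U^\perp}|\neq 0\}.$$ Then for each $i\in\{d,\ldots,n-t\}$, $(E,B(i),f)$ with $f(X):=|C_{=X^\perp}|$ is a weighted $t$-design over $\mathbb{F}_q$ with blocks of dimension $i$;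 that is, there is an integer $\lambda$ (depending on $i$) such that $$\sum_{X\in B(i),\ T\le X} |C_{=X^\perp}|=\lambda$$ for every $t$-dimensional subspace $T$ of $E$. -/

import Mathlib

/-- The column space `col(A)` of an `n × m` matrix `A`: the image of `v ↦ A v`, i.e. the span of the
columns of `A`. Its dimension is `A.rank`. -/
def colSpace {F : Type*} [Field F] {n m : ℕ} (A : Matrix (Fin n) (Fin m) F) :
    Submodule F (Fin n → F) :=
  LinearMap.range A.mulVecLin

/-- `C` is an `F`-`[n × m, k, d]` rank-metric code: an `F`-linear space of `n × m` matrices of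
dimension `k`, whose minimum distance (the least rank of a nonzero member) is `d`. -/
structure IsRankMetricCode {F : Type*} [Field F] {n m : ℕ}
    (C : Submodule F (Matrix (Fin n) (Fin m) F)) (k d : ℕ) : Prop where
  finrank_eq : Module.finrank F C = k
  isLeast_rank : IsLeast {r : ℕ | ∃ A ∈ C, A ≠ 0 ∧ A.rank = r} d

/-- The dual code `C^⊥ = {Y | Tr(X Yᵀ) = 0 for all X ∈ C}`. -/
def dualCode {F : Type*} [Field F] {n m : ℕ} (C : Submodule F (Matrix (Fin n) (Fin m) F)) :
    Submodule F (Matrix (Fin n) (Fin m) F) where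
  carrier := {Y | ∀ X ∈ C, (X * Y.transpose).trace = 0}
  add_mem' := by
    intro Y Z hY hZ X hX
    rw [Matrix.transpose_add, Matrix.mul_add, Matrix.trace_add, hY X hX, hZ X hX, add_zero]
  zero_mem' := by
    intro X _
    simp
  smul_mem' := by
    intro c Y hY X hX
    rw [Matrix.transpose_smul, Matrix.mul_smul, Matrix.trace_smul, hY X hX, smul_zero]

/-- The set of rank weights of a code, i.e. of the ranks of its members. -/
def rankWeights {F : Type*} [Field F] {n m : ℕ} (C : Submodule F (Matrix (Fin n) (Fin m) F)) :
    Set ℕ :=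
  {w | ∃ Y ∈ C, Y.rank = w}

/-- `C_{=U} = {A ∈ C | col(A) = U^⊥}`, where `U^⊥` is the orthogonal complement of `U` with respect
to the bilinear form `b`. -/
def codewordsEq {F : Type*} [Field F] {n m : ℕ} (b : LinearMap.BilinForm F (Fin n → F))
    (C : Submodule F (Matrix (Fin n) (Fin m) F)) (U : Submodule F (Fin n → F)) :
    Set (Matrix (Fin n) (Fin m) F) :=
  {A | A ∈ C ∧ colSpace A = b.orthogonal U}

/-- `(E, 𝓑, f)` is a weighted `t`-`(n, k, lam; q)` design over `F`, where `E` has dimension `n` over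
the finite field `F` of order `q`: `t` and `k` are positive, the blocks (members of `𝓑`) are
`k`-dimensional subspaces of `E`, and for each `t`-dimensional subspace `T` of `E` the weights of the
blocks containing `T` add up to `lam`. (As `E` is finite, so is the sum.) -/
structure IsWeightedSubspaceDesign (F : Type*) [Field F] [Finite F] {E : Type*} [AddCommGroup E]
    [Module F E] [FiniteDimensional F E] {G : Type*} [AddCommGroup G] (t k : ℕ) (lam : G)
    (𝓑 : Set (Submodule F E)) (f : 𝓑 → G) : Prop where
  t_pos : 0 < t
  k_pos : 0 < k
  finrank_block : ∀ B ∈ 𝓑, Module.finrank F B = k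
  sum_eq : ∀ T : Submodule F E, Module.finrank F T = t →
    ∑ᶠ (B : 𝓑) (_ : T ≤ (B : Submodule F E)), f B = lam

/-- `B(i) = {U ≤ E | dim U = i, |C_{=U^⊥}| ≠ 0}`. -/
def supportBlocks {F : Type*} [Field F] {n m : ℕ} (b : LinearMap.BilinForm F (Fin n → F))
    (C : Submodule F (Matrix (Fin n) (Fin m) F)) (i : ℕ) : Set (Submodule F (Fin n → F)) :=
  {U | Module.finrank F U = i ∧ (codewordsEq b C (b.orthogonal U)).ncard ≠ 0}

/-! As `b` is symmetric and non-degenerate, double complements cancel and the sum over the blocks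
above T counts the codewords of rank i whose column space contains T. The point is that this number
depends only on dim T. Below, q = |F| and complements are taken for the dot product, to which the
trace form reduces column by column.

For dim S = s ≤ t, the shortening {Y ∈ C^⊥ : col Y ≤ S^⊥} has at most d - s nonzero ranks. No
nonzero word of C has its column space inside a space of dimension below d, so MacWilliams duality
fixes the first d - s moments ∑ q^(j(n - rank Y)), and Vandermonde recovers the rank distribution
(`exists_equiv_dualCode_within_rank_eq`). Duality carries this back to the distribution of dim(col A
⊔ S) over A ∈ C (`card_finrank_colSpace_sup_eq`). Knowing these for all dim S ≤ t gives the joint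
distribution of dim(col A) and dim(col A ⊓ T) (`card_finrank_inf_eq`); its value at (i, t) is λ. -/

/-! ### Fibre counts and exponential moments. -/

open Module in
/-- Subspaces of equal dimension in spaces of equal dimension correspond under an isomorphism. -/
theorem exists_linearEquiv_map_eq {K V V' : Type*} [Field K] [AddCommGroup V] [Module K V]
    [AddCommGroup V'] [Module K V'] [FiniteDimensional K V] [FiniteDimensional K V']
    (hV : finrank K V = finrank K V') (W : Submodule K V) (W' : Submodule K V')
    (hW : finrank K W = finrank K W') : ∃ e : V ≃ₗ[K] V', W.map (e : V →ₗ[K] V') = W' := by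
  obtain ⟨U, hU⟩ := W.exists_isCompl
  obtain ⟨U', hU'⟩ := W'.exists_isCompl
  have h1 := Submodule.finrank_add_eq_of_isCompl hU
  have h2 := Submodule.finrank_add_eq_of_isCompl hU'
  let e₁ : W ≃ₗ[K] W' := LinearEquiv.ofFinrankEq _ _ hW
  let e₂ : U ≃ₗ[K] U' := LinearEquiv.ofFinrankEq _ _ (by omega)
  let e : V ≃ₗ[K] V' := (W.prodEquivOfIsCompl U hU).symm ≪≫ₗ (e₁.prodCongr e₂) ≪≫ₗ
    W'.prodEquivOfIsCompl U' hU'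
  refine ⟨e, Submodule.eq_of_le_of_finrank_eq ?_ ?_⟩
  · rintro _ ⟨x, hx, rfl⟩
    have : (W.prodEquivOfIsCompl U hU).symm x = (⟨x, hx⟩, 0) :=
      Submodule.prodEquivOfIsCompl_symm_apply_left W U hU ⟨x, hx⟩
    simp [e, this]
  · rw [LinearEquiv.finrank_map_eq, hW]

/-- Two functions on finite types whose fibres have the same sizes differ by a bijection. -/
theorem exists_equiv_comp_eq {ι ι' κ : Type*} [Finite ι] [Finite ι'] (g : ι → κ) (g' : ι' → κ)
    (h : ∀ w, Nat.card {a // g a = w} = Nat.card {a // g' a = w}) :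
    ∃ e : ι ≃ ι', ∀ a, g' (e a) = g a := by
  have e (w : κ) : {a // g a = w} ≃ {a // g' a = w} :=
    (Finite.equivFinOfCardEq (h w)).trans (Finite.equivFin _).symm
  refine ⟨(Equiv.sigmaFiberEquiv g).symm.trans
    ((Equiv.sigmaCongrRight e).trans (Equiv.sigmaFiberEquiv g')), fun a => ?_⟩
  exact (e (g a) ⟨a, rfl⟩).2

/-- Vandermonde: an integer combination of the geometric progressions with ratios `Q ^ w`, `w ∈ I`,
that vanishes in its first `|I|` places has zero coefficients. -/
theorem eq_zero_of_sum_mul_pow_eq_zero {Q : ℕ} (hQ : 1 < Q) (I : Finset ℕ) (c : ℕ → ℤ)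
    (h : ∀ j < I.card, ∑ w ∈ I, c w * (Q : ℤ) ^ (j * w) = 0) : ∀ w ∈ I, c w = 0 := by
  let σ := I.equivFin.symm
  have key : (fun i => c (σ i)) = 0 := by
    refine Matrix.eq_zero_of_forall_pow_sum_mul_pow_eq_zero
      (f := fun i => (Q : ℤ) ^ (σ i : ℕ)) ?_ ?_
    · intro x y hxy
      have : Q ^ (σ x : ℕ) = Q ^ (σ y : ℕ) := by
        have hxy : (Q : ℤ) ^ (σ x : ℕ) = (Q : ℤ) ^ (σ y : ℕ) := hxy
        exact_mod_cast hxy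
      exact σ.injective (Subtype.ext (Nat.pow_right_injective hQ this))
    · intro j
      rw [Equiv.sum_comp σ (fun w : I => c w * ((Q : ℤ) ^ (w : ℕ)) ^ (j : ℕ)),
        Finset.sum_coe_sort I (fun w => c w * ((Q : ℤ) ^ w) ^ (j : ℕ)), ← h j j.2]
      exact Finset.sum_congr rfl fun w _ => by rw [← pow_mul, mul_comm w]
  intro w hw
  simpa [σ] using congrFun key (I.equivFin ⟨w, hw⟩)

open Classical in
/-- The exponential moments of a function, in terms of the sizes of its fibres. -/
theorem sum_card_fiber_mul_pow {κ : Type*} [Fintype κ] (Q : ℕ) (I : Finset ℕ) (f : κ → ℕ)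
    (hf : ∀ a, f a ∈ I) (j : ℕ) :
    ∑ w ∈ I, (Nat.card {a // f a = w} : ℤ) * (Q : ℤ) ^ (j * w)
      = ((∑ a, Q ^ (j * f a) : ℕ) : ℤ) := by
  push_cast
  rw [← Finset.sum_fiberwise_of_maps_to (s := Finset.univ) (t := I) (fun a _ => hf a)]
  refine Finset.sum_congr rfl fun w _ => ?_
  rw [Finset.sum_congr rfl (g := fun _ => (Q : ℤ) ^ (j * w)) (fun a ha => by
    rw [(Finset.mem_filter.mp ha).2])]
  rw [Finset.sum_const, nsmul_eq_mul, Nat.card_eq_fintype_card, Fintype.card_subtype]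

/-- A function with values in `insert w₀ I` is determined, up to a bijection of its domain, by the
size of its fibre over `w₀` and its first `|I|` exponential moments. -/
theorem exists_equiv_comp_eq_of_sum_pow {ι ι' : Type*} [Fintype ι] [Fintype ι'] {Q : ℕ}
    (hQ : 1 < Q) (I : Finset ℕ) (w₀ : ℕ) (hw₀ : w₀ ∉ I) (g : ι → ℕ) (g' : ι' → ℕ)
    (hg : ∀ a, g a ∈ insert w₀ I) (hg' : ∀ a, g' a ∈ insert w₀ I)
    (h₀ : Nat.card {a // g a = w₀} = Nat.card {a // g' a = w₀})
    (h : ∀ j < I.card, ∑ a, Q ^ (j * g a) = ∑ a, Q ^ (j * g' a)) :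
    ∃ e : ι ≃ ι', ∀ a, g' (e a) = g a := by
  refine exists_equiv_comp_eq g g' fun w => ?_
  by_cases hw : w ∈ insert w₀ I
  · rcases Finset.mem_insert.mp hw with rfl | hw
    · exact h₀
    -- The `w₀` terms cancel by `h₀`, leaving as many equations as unknown differences of fibre
    -- sizes.
    have := eq_zero_of_sum_mul_pow_eq_zero hQ I
      (fun w => (Nat.card {a // g a = w} : ℤ) - Nat.card {a // g' a = w}) (fun j hj => by
        have h1 := sum_card_fiber_mul_pow Q _ g hg j
        rw [h j hj, ← sum_card_fiber_mul_pow Q _ g' hg' j, Finset.sum_insert hw₀,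
          Finset.sum_insert hw₀, h₀] at h1
        simp only [sub_mul, Finset.sum_sub_distrib]
        exact sub_eq_zero.mpr (add_left_cancel h1)) w hw
    exact_mod_cast sub_eq_zero.mp this
  · have : IsEmpty {a // g a = w} := ⟨fun a => hw (a.2 ▸ hg a)⟩
    have : IsEmpty {a // g' a = w} := ⟨fun a => hw (a.2 ▸ hg' a)⟩
    simp

open Classical in
/-- The exponential moments of the dimensions of a family of subspaces count the tuples of vectors
together with the members of the family that contain them. -/
theorem sum_card_pow_finrank {K V ι : Type*} [Field K] [Finite K] [AddCommGroup V] [Module K V]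
    [FiniteDimensional K V] [Fintype ι] (U : ι → Submodule K V) (j : ℕ) [Fintype (Fin j → V)] :
    ∑ a, Nat.card K ^ (j * Module.finrank K (U a))
      = ∑ x : Fin j → V, Nat.card {a // Submodule.span K (Set.range x) ≤ U a} := by
  have : Finite V := Module.finite_of_finite K
  -- |K|^(j dim U) = |U|^j counts the j-tuples in U; the rest is double counting.
  have hL (a : ι) : Nat.card K ^ (j * Module.finrank K (U a))
      = (Finset.univ.filter fun x : Fin j → V => Submodule.span K (Set.range x) ≤ U a).card := by
    rw [← Fintype.card_subtype, ← Nat.card_eq_fintype_card, mul_comm, pow_mul,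
      ← Module.natCard_eq_pow_finrank]
    rw [show Nat.card (U a) ^ j = Nat.card (Fin j → U a) by simp [Nat.card_pi]]
    refine Nat.card_congr ⟨fun x => ⟨fun l => x l, ?_⟩, fun x l => ⟨x.1 l, ?_⟩, ?_, ?_⟩
    · rw [Submodule.span_le, Set.range_subset_iff]
      exact fun l => (x l).2
    · exact x.2 (Submodule.subset_span ⟨l, rfl⟩)
    · exact fun x => rfl
    · exact fun x => rfl
  have hR (x : Fin j → V) : Nat.card {a // Submodule.span K (Set.range x) ≤ U a}
      = (Finset.univ.filter fun a => Submodule.span K (Set.range x) ≤ U a).card := by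
    rw [← Fintype.card_subtype, ← Nat.card_eq_fintype_card]
  simp only [hL, hR]
  exact (Finset.sum_card_bipartiteAbove_eq_sum_card_bipartiteBelow _)

open Classical in
/-- A finite set is counted by the fibres of a map on it. -/
theorem card_subtype_eq_sum_fiber {ι κ : Type*} [Finite ι] (p : ι → Prop) (g : ι → κ)
    (I : Finset κ) (hg : ∀ a, p a → g a ∈ I) :
    Nat.card {a // p a} = ∑ r ∈ I, Nat.card {a // p a ∧ g a = r} := by
  have := Fintype.ofFinite ι
  simp only [Nat.card_eq_fintype_card, Fintype.card_subtype]
  rw [Finset.card_eq_sum_card_fiberwise (t := I) (f := g) (by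
    intro a ha
    exact hg a (by simpa using ha))]
  simp [Finset.filter_filter]

/-! ### From sums to intersections. -/

open Module Submodule in
/-- If the distribution of `dim (W a ⊔ S)` depends only on `dim S` for `dim S ≤ t`, then so does the
joint distribution of `dim (W a)` and `dim (W a ⊓ S)`. -/
theorem card_finrank_inf_eq {K V ι : Type*} [Field K] [Finite K] [AddCommGroup V] [Module K V]
    [FiniteDimensional K V] [Finite ι] (W : ι → Submodule K V) (t : ℕ)
    (h : ∀ S S' : Submodule K V, finrank K S = finrank K S' → finrank K S ≤ t → ∀ j,
      Nat.card {a // finrank K ↥(W a ⊔ S) = j} = Nat.card {a // finrank K ↥(W a ⊔ S') = j})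
    (s : ℕ) (hs : s ≤ t) (i : ℕ) (S S' : Submodule K V) (hS : finrank K S = s)
    (hS' : finrank K S' = s) (r : ℕ) :
    Nat.card {a // finrank K (W a) = i ∧ finrank K ↥(W a ⊓ S) = r}
      = Nat.card {a // finrank K (W a) = i ∧ finrank K ↥(W a ⊓ S') = r} := by
  classical
  have := Fintype.ofFinite ι
  have : Finite V := Module.finite_of_finite K
  -- The induction on s supplies the moments of dim(W a ⊓ S), the one on i the fibre where S ≤ W a.
  induction s using Nat.strong_induction_on generalizing i S S' r with
  | _ s ih =>
  induction i using Nat.strong_induction_on generalizing r with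
  | _ i ihi =>
  have hinf (S : Submodule K V) (hS : finrank K S = s) (a : ι) :
      finrank K ↥(W a ⊓ S) ≤ s := hS ▸ Submodule.finrank_mono inf_le_right
  have hsup (S : Submodule K V) (hS : finrank K S = s) (hi : s ≤ i) :
      Nat.card {a // finrank K ↥(W a ⊔ S) = i} = ∑ r ∈ Finset.range (s + 1),
        Nat.card {a // finrank K (W a) = i - s + r ∧ finrank K ↥(W a ⊓ S) = r} := by
    rw [card_subtype_eq_sum_fiber _ (fun a => finrank K ↥(W a ⊓ S)) (Finset.range (s + 1))
      (fun a _ => by have := hinf S hS a; simp; omega)]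
    refine Finset.sum_congr rfl fun r hr => Nat.card_congr (Equiv.subtypeEquivRight fun a => ?_)
    have := Submodule.finrank_sup_add_finrank_inf_eq (W a) S
    rw [Finset.mem_range] at hr
    omega
  have htop : Nat.card {a // finrank K (W a) = i ∧ finrank K ↥(W a ⊓ S) = s}
      = Nat.card {a // finrank K (W a) = i ∧ finrank K ↥(W a ⊓ S') = s} := by
    by_cases hi : s ≤ i
    -- In `hsup` only the term r = s has dim W a = i; the others have smaller dimension and agree by
    -- `ihi`.
    · have key := h S S' (hS.trans hS'.symm) (hS.trans_le hs) i
      rw [hsup S hS hi, hsup S' hS' hi, Finset.sum_range_succ, Finset.sum_range_succ,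
        Finset.sum_congr rfl (fun r hr => ihi (i - s + r) (by
          rw [Finset.mem_range] at hr; omega) r), Nat.sub_add_cancel hi] at key
      exact Nat.add_left_cancel key
    · have hemp (S : Submodule K V) :
          IsEmpty {a // finrank K (W a) = i ∧ finrank K ↥(W a ⊓ S) = s} :=
        ⟨fun a => hi (by
          have := Submodule.finrank_mono (inf_le_left : W a ⊓ S ≤ W a)
          rwa [a.2.1, a.2.2] at this)⟩
      have := hemp S
      have := hemp S'
      simp
  -- A j-tuple in S spans some R with dim R ≤ j < s, and R ≤ W a means dim(W a ⊓ R) = dim R, so `ih`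
  -- counts such a.
  have hmom (j : ℕ) (hj : j < s) :
      ∑ a : {a // finrank K (W a) = i}, Nat.card K ^ (j * finrank K ↥(W a ⊓ S))
        = ∑ a : {a // finrank K (W a) = i}, Nat.card K ^ (j * finrank K ↥(W a ⊓ S')) := by
    have hcomap (S : Submodule K V) (a : ι) :
        finrank K ↥(W a ⊓ S) = finrank K ↥((W a).comap S.subtype) := by
      rw [← Submodule.finrank_map_subtype_eq S ((W a).comap S.subtype), Submodule.map_comap_subtype,
        inf_comm]
    have := Fintype.ofFinite (Fin j → S)
    have := Fintype.ofFinite (Fin j → S')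
    simp only [hcomap]
    rw [sum_card_pow_finrank (fun a : {a // finrank K (W a) = i} => (W a).comap S.subtype),
      sum_card_pow_finrank (fun a : {a // finrank K (W a) = i} => (W a).comap S'.subtype)]
    have hcount (S : Submodule K V) (R : Submodule K S) :
        Nat.card {a : {a // finrank K (W a) = i} // R ≤ (W a).comap S.subtype}
          = Nat.card {a // finrank K (W a) = i ∧
              finrank K ↥(W a ⊓ R.map S.subtype) = finrank K R} := by
      refine Nat.card_congr ((Equiv.subtypeSubtypeEquivSubtypeInter (fun a => finrank K (W a) = i)
        (fun a => R ≤ (W a).comap S.subtype)).trans (Equiv.subtypeEquivRight fun a => ?_))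
      rw [← Submodule.map_le_iff_le_comap, ← inf_eq_right]
      refine and_congr_right fun _ => ⟨fun h => by rw [h, Submodule.finrank_map_subtype_eq],
        fun h => Submodule.eq_of_le_of_finrank_eq inf_le_right ?_⟩
      rw [h, Submodule.finrank_map_subtype_eq]
    let e : S ≃ₗ[K] S' := LinearEquiv.ofFinrankEq _ _ (hS.trans hS'.symm)
    refine Fintype.sum_equiv (Equiv.piCongrRight fun _ => e.toEquiv) _ _ fun x => ?_
    have hspan : span K (Set.range (Equiv.piCongrRight (fun _ : Fin j => e.toEquiv) x))
        = (span K (Set.range x)).map (e : S →ₗ[K] S') := by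
      rw [Submodule.map_span, ← Set.range_comp]
      rfl
    have hle : finrank K (span K (Set.range x)) ≤ j :=
      (finrank_range_le_card (R := K) x).trans_eq (Fintype.card_fin j)
    rw [hspan, hcount, hcount, LinearEquiv.finrank_map_eq]
    refine ih _ (hle.trans_lt hj) (hle.trans (hj.le.trans hs)) i _ _ ?_ ?_ _
    · rw [Submodule.finrank_map_subtype_eq]
    · rw [Submodule.finrank_map_subtype_eq, LinearEquiv.finrank_map_eq]
  have hflat (S : Submodule K V) (r : ℕ) :
      Nat.card {a : {a // finrank K (W a) = i} // finrank K ↥(W a ⊓ S) = r}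
        = Nat.card {a // finrank K (W a) = i ∧ finrank K ↥(W a ⊓ S) = r} :=
    Nat.card_congr (Equiv.subtypeSubtypeEquivSubtypeInter (fun a => finrank K (W a) = i)
      (fun a => finrank K ↥(W a ⊓ S) = r))
  have hmem (S : Submodule K V) (hS : finrank K S = s) (a : ι) :
      finrank K ↥(W a ⊓ S) ∈ insert s (Finset.range s) := by
    have := hinf S hS a
    rw [Finset.mem_insert, Finset.mem_range]
    omega
  obtain ⟨e, he⟩ := exists_equiv_comp_eq_of_sum_pow (Finite.one_lt_card (α := K))
    (Finset.range s) s (by simp) (fun a : {a // finrank K (W a) = i} => finrank K ↥(W a ⊓ S))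
    (fun a : {a // finrank K (W a) = i} => finrank K ↥(W a ⊓ S')) (fun a => hmem S hS a)
    (fun a => hmem S' hS' a) (by rw [hflat, hflat, htop])
    (fun j hj => hmom j (by rwa [Finset.card_range] at hj))
  rw [← hflat, ← hflat]
  exact Nat.card_congr (e.subtypeEquiv fun a => by rw [he a])

/-! ### The trace form and MacWilliams duality. -/

/-- The bilinear form `(X, Y) ↦ Tr(X Yᵀ)` on matrices. -/
def matrixTraceForm (F : Type*) [Field F] (n m : ℕ) :
    LinearMap.BilinForm F (Matrix (Fin n) (Fin m) F) :=
  LinearMap.mk₂ F (fun X Y => (X * Y.transpose).trace)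
    (fun X Y Z => by rw [Matrix.add_mul, Matrix.trace_add])
    (fun c X Y => by rw [Matrix.smul_mul, Matrix.trace_smul])
    (fun X Y Z => by rw [Matrix.transpose_add, Matrix.mul_add, Matrix.trace_add])
    (fun c X Y => by rw [Matrix.transpose_smul, Matrix.mul_smul, Matrix.trace_smul])

/-- The standard bilinear form on `F ^ n`. -/
def dotForm (F : Type*) [Field F] (n : ℕ) : LinearMap.BilinForm F (Fin n → F) :=
  dotProductBilin F F

/-- The space of the matrices whose columns lie in `V`. -/
def matricesWithin {F : Type*} [Field F] {n : ℕ} (m : ℕ) (V : Submodule F (Fin n → F)) :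
    Submodule F (Matrix (Fin n) (Fin m) F) where
  carrier := {A | ∀ j, A.col j ∈ V}
  add_mem' hA hB j := V.add_mem (hA j) (hB j)
  zero_mem' _ := V.zero_mem
  smul_mem' c _ hA j := V.smul_mem c (hA j)

section

open Module

variable {F : Type*} [Field F] {n m : ℕ}

theorem matrixTraceForm_apply (X Y : Matrix (Fin n) (Fin m) F) :
    matrixTraceForm F n m X Y = ∑ j, dotForm F n (X.col j) (Y.col j) := by
  change (X * Y.transpose).trace = _
  rw [Matrix.trace_mul_comm]
  exact Finset.sum_congr rfl fun j _ => dotProduct_comm (Y.col j) (X.col j)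

theorem dotForm_isSymm : (dotForm F n).IsSymm :=
  ⟨fun x y => dotProduct_comm x y⟩

theorem dotForm_nondegenerate : (dotForm F n).Nondegenerate :=
  ⟨fun x hx => dotProduct_eq_zero x hx,
    fun x hx => dotProduct_eq_zero x fun w => (dotProduct_comm x w).trans (hx w)⟩

theorem mem_matricesWithin_iff {V : Submodule F (Fin n → F)} {A : Matrix (Fin n) (Fin m) F} :
    A ∈ matricesWithin m V ↔ colSpace A ≤ V := by
  rw [colSpace, Matrix.range_mulVecLin, Submodule.span_le, Set.range_subset_iff]
  rfl

theorem finrank_matricesWithin (V : Submodule F (Fin n → F)) :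
    finrank F (matricesWithin m V) = m * finrank F V := by
  let e : matricesWithin m V ≃ₗ[F] (Fin m → V) :=
    { toFun := fun A j => ⟨A.1.col j, A.2 j⟩
      invFun := fun v => ⟨Matrix.of fun i j => (v j : Fin n → F) i, fun j => (v j).2⟩
      map_add' := fun _ _ => rfl
      map_smul' := fun _ _ => rfl
      left_inv := fun _ => rfl
      right_inv := fun _ => rfl }
  rw [e.finrank_eq, Module.finrank_pi_fintype, Finset.sum_const, Finset.card_univ,
    Fintype.card_fin, smul_eq_mul]

theorem matrixTraceForm_isSymm : (matrixTraceForm F n m).IsSymm :=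
  ⟨fun X Y => by
    simp only [matrixTraceForm_apply]
    exact Finset.sum_congr rfl fun j _ => dotForm_isSymm.eq _ _⟩

/-- The trace form is the sum of the dot products of corresponding columns, so it suffices to test
against matrices with a single nonzero column taken from V. -/
theorem matrixTraceForm_orthogonal_matricesWithin (V : Submodule F (Fin n → F)) :
    (matrixTraceForm F n m).orthogonal (matricesWithin m V)
      = matricesWithin m ((dotForm F n).orthogonal V) := by
  ext Y
  constructor
  · intro h j v hv
    have := h (Matrix.vecMulVec v (Pi.single j 1)) fun l => by
      have : (Matrix.vecMulVec v (Pi.single j (1 : F))).col l = (Pi.single j (1 : F) : _ → F) l • v := by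
        ext i
        simp [Matrix.vecMulVec_apply, mul_comm]
      rw [this]
      exact V.smul_mem _ hv
    rw [matrixTraceForm_apply, Finset.sum_eq_single j] at this
    · have hcol : (Matrix.vecMulVec v (Pi.single j (1 : F))).col j = v := by
        ext i
        simp [Matrix.vecMulVec_apply]
      rwa [hcol] at this
    · intro l _ hl
      have : (Matrix.vecMulVec v (Pi.single j (1 : F))).col l = 0 := by
        ext i
        simp [Matrix.vecMulVec_apply, hl]
      rw [this, map_zero, LinearMap.zero_apply]
    · simp
  · intro h X hX
    rw [matrixTraceForm_apply]
    exact Finset.sum_eq_zero fun j _ => h j _ (hX j)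

theorem matrixTraceForm_nondegenerate : (matrixTraceForm F n m).Nondegenerate := by
  have : (matrixTraceForm F n m).SeparatingRight := fun Y hY => by
    have h : Y ∈ (matrixTraceForm F n m).orthogonal (matricesWithin m ⊤) := fun X _ => hY X
    rw [matrixTraceForm_orthogonal_matricesWithin,
      LinearMap.BilinForm.orthogonal_top_eq_bot dotForm_nondegenerate] at h
    ext i j
    exact congrFun (h j) i
  exact ⟨fun X hX => this X fun Y => (matrixTraceForm_isSymm.eq _ _).symm.trans (hX Y), this⟩

theorem dualCode_eq_orthogonal (C : Submodule F (Matrix (Fin n) (Fin m) F)) :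
    dualCode C = (matrixTraceForm F n m).orthogonal C :=
  rfl

/-- MacWilliams duality between the shortened codes of a code and those of its dual. -/
theorem card_dualCode_within_mul [Finite F] (C : Submodule F (Matrix (Fin n) (Fin m) F))
    (V : Submodule F (Fin n → F)) :
    Nat.card {Y // Y ∈ dualCode C ∧ colSpace Y ≤ (dotForm F n).orthogonal V}
        * (Nat.card C * Nat.card F ^ (m * finrank F V))
      = Nat.card {A // A ∈ C ∧ colSpace A ≤ V} * Nat.card F ^ (m * n) := by
  have hcard (D : Submodule F (Matrix (Fin n) (Fin m) F)) (U : Submodule F (Fin n → F)) :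
      Nat.card {Y // Y ∈ D ∧ colSpace Y ≤ U}
        = Nat.card F ^ finrank F ↥(D ⊓ matricesWithin m U) := by
    rw [← Module.natCard_eq_pow_finrank]
    exact Nat.card_congr (Equiv.subtypeEquivRight fun Y => by
      rw [Submodule.mem_inf, mem_matricesWithin_iff])
  -- The shortened dual is the complement of a sum, whose dimension is tied to that of the shortened
  -- code by the modular dimension formula.
  have hsup : dualCode C ⊓ matricesWithin m ((dotForm F n).orthogonal V)
      = (matrixTraceForm F n m).orthogonal (C ⊔ matricesWithin m V) := by
    rw [dualCode_eq_orthogonal, ← matrixTraceForm_orthogonal_matricesWithin]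
    refine le_antisymm ?_ (le_inf (LinearMap.BilinForm.orthogonal_le le_sup_left)
      (LinearMap.BilinForm.orthogonal_le le_sup_right))
    rintro Y ⟨h1, h2⟩ X hX
    obtain ⟨A, hA, B, hB, rfl⟩ := Submodule.mem_sup.mp hX
    rw [map_add, LinearMap.add_apply, h1 A hA, h2 B hB, add_zero]
  rw [hcard, hcard, Module.natCard_eq_pow_finrank (K := F) (V := C), ← pow_add, ← pow_add, ← pow_add,
    hsup, LinearMap.BilinForm.finrank_orthogonal matrixTraceForm_nondegenerate]
  congr 1
  have h1 := Submodule.finrank_sup_add_finrank_inf_eq C (matricesWithin m V)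
  have h2 := Submodule.finrank_le (C ⊔ matricesWithin m V)
  rw [Module.finrank_matrix, Fintype.card_fin, Fintype.card_fin, finrank_self, mul_one,
    mul_comm n m] at *
  rw [finrank_matricesWithin] at h1
  omega

end

/-! ### Rank distributions of shortened and punctured codes. -/

section

open Module Submodule

open Classical in
/-- A sum over the tuples that span a space above `W`, with weights given by the dimension of the
span, depends only on the dimensions of `W` and of the ambient space. -/
theorem sum_ite_le_span_eq {K V V' M : Type*} [Field K] [AddCommGroup V] [Module K V]
    [AddCommGroup V'] [Module K V'] [FiniteDimensional K V] [FiniteDimensional K V']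
    [AddCommMonoid M] (hV : finrank K V = finrank K V') (W : Submodule K V) (W' : Submodule K V')
    (hW : finrank K W = finrank K W') (j : ℕ) [Fintype (Fin j → V)] [Fintype (Fin j → V')]
    (c : ℕ → M) :
    (∑ x : Fin j → V, if W ≤ span K (Set.range x) then c (finrank K (span K (Set.range x))) else 0)
      = ∑ x : Fin j → V',
        if W' ≤ span K (Set.range x) then c (finrank K (span K (Set.range x))) else 0 := by
  obtain ⟨e, rfl⟩ := exists_linearEquiv_map_eq hV W W' hW
  refine Fintype.sum_equiv (Equiv.piCongrRight fun _ => e.toEquiv) _ _ fun x => ?_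
  have hspan : span K (Set.range (Equiv.piCongrRight (fun _ : Fin j => e.toEquiv) x))
      = (span K (Set.range x)).map (e : V →ₗ[K] V') := by
    rw [Submodule.map_span, ← Set.range_comp]
    rfl
  rw [hspan, LinearEquiv.finrank_map_eq]
  refine if_congr ?_ rfl rfl
  exact (Submodule.map_le_map_iff_of_injective e.injective _ _).symm

variable {F : Type*} [Field F] {n m : ℕ}

theorem le_dotForm_orthogonal_comm {U V : Submodule F (Fin n → F)} :
    U ≤ (dotForm F n).orthogonal V ↔ V ≤ (dotForm F n).orthogonal U :=
  ⟨fun h v hv _ hu => (dotForm_isSymm.eq _ _).symm.trans (h hu v hv),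
    fun h u hu _ hv => (dotForm_isSymm.eq _ _).symm.trans (h hv u hu)⟩

theorem le_dotForm_orthogonal_sup {U S V : Submodule F (Fin n → F)} :
    U ≤ (dotForm F n).orthogonal (S ⊔ V)
      ↔ U ≤ (dotForm F n).orthogonal S ∧ U ≤ (dotForm F n).orthogonal V := by
  rw [le_dotForm_orthogonal_comm, sup_le_iff, le_dotForm_orthogonal_comm,
    le_dotForm_orthogonal_comm (U := V)]

theorem finrank_dotForm_orthogonal (V : Submodule F (Fin n → F)) :
    finrank F ((dotForm F n).orthogonal V) = n - finrank F V := by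
  rw [LinearMap.BilinForm.finrank_orthogonal dotForm_nondegenerate, finrank_fin_fun]

theorem eq_zero_of_rank_eq_zero {A : Matrix (Fin n) (Fin m) F} (h : A.rank = 0) : A = 0 := by
  have h1 : colSpace A = ⊥ := Submodule.finrank_eq_zero.mp h
  have h2 := mem_matricesWithin_iff.mpr h1.le
  ext i j
  exact congrFun ((Submodule.mem_bot F).mp (h2 j)) i

variable [Finite F]

/-- Below the minimum distance, the sizes of the shortened dual codes depend only on the
dimension. -/
theorem card_dualCode_within_eq {C : Submodule F (Matrix (Fin n) (Fin m) F)} {d : ℕ}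
    (hd : ∀ A ∈ C, A ≠ 0 → d ≤ A.rank) {V V' : Submodule F (Fin n → F)}
    (h : finrank F V = finrank F V') (hV : finrank F V < d) :
    Nat.card {Y // Y ∈ dualCode C ∧ colSpace Y ≤ (dotForm F n).orthogonal V}
      = Nat.card {Y // Y ∈ dualCode C ∧ colSpace Y ≤ (dotForm F n).orthogonal V'} := by
  have hone (V : Submodule F (Fin n → F)) (hV : finrank F V < d) :
      Nat.card {A // A ∈ C ∧ colSpace A ≤ V} = 1 := by
    rw [Nat.card_eq_one_iff_unique]
    refine ⟨⟨fun A B => ?_⟩, ⟨⟨0, C.zero_mem, ?_⟩⟩⟩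
    · have hz (A : {A // A ∈ C ∧ colSpace A ≤ V}) : A.1 = 0 := by
        by_contra hA
        have h1 := hd A.1 A.2.1 hA
        have h2 : A.1.rank ≤ finrank F V := Submodule.finrank_mono A.2.2
        omega
      exact Subtype.ext ((hz A).trans (hz B).symm)
    · exact mem_matricesWithin_iff.mp (zero_mem _)
  have h1 := card_dualCode_within_mul C V
  have h2 := card_dualCode_within_mul C V'
  rw [hone V hV] at h1
  rw [hone V' (h ▸ hV), ← h, ← h1] at h2
  refine (Nat.eq_of_mul_eq_mul_right (Nat.mul_pos Nat.card_pos ?_) h2).symm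
  exact pow_pos Nat.card_pos _

/-- If the dual code has few ranks, then the rank distribution of its shortening at `S` depends only
on `dim S`. -/
theorem exists_equiv_dualCode_within_rank_eq {C : Submodule F (Matrix (Fin n) (Fin m) F)} {d s : ℕ}
    (hd : ∀ A ∈ C, A ≠ 0 → d ≤ A.rank)
    (hw : (rankWeights (dualCode C) ∩ Set.Icc 1 (n - s)).ncard ≤ d - s)
    {S S' : Submodule F (Fin n → F)} (hS : finrank F S = s) (hS' : finrank F S' = s) :
    ∃ e : {Y // Y ∈ dualCode C ∧ colSpace Y ≤ (dotForm F n).orthogonal S} ≃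
        {Y // Y ∈ dualCode C ∧ colSpace Y ≤ (dotForm F n).orthogonal S'},
      ∀ Y, (e Y).1.rank = Y.1.rank := by
  classical
  have hfin : (rankWeights (dualCode C) ∩ Set.Icc 1 (n - s)).Finite :=
    (Set.finite_Icc 1 (n - s)).inter_of_right _
  -- Coranks replace ranks because V ≤ (col Y)^⊥ is the countable condition; n, attained only at Y =
  -- 0, is the exceptional value.
  let I : Finset ℕ := hfin.toFinset.image (n - ·)
  have hI : I.card ≤ d - s :=
    Finset.card_image_le.trans ((Set.ncard_eq_toFinset_card _ hfin).symm.trans_le hw)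
  let D (S : Submodule F (Fin n → F)) : Type _ :=
    {Y // Y ∈ dualCode C ∧ colSpace Y ≤ (dotForm F n).orthogonal S}
  have hDfin (S) : Fintype (D S) := Fintype.ofFinite _
  have hFfin (j : ℕ) : Fintype (Fin j → Fin n → F) := Fintype.ofFinite _
  let g (S) (Y : D S) : ℕ := finrank F ((dotForm F n).orthogonal (colSpace Y.1))
  have hg (S) (Y : D S) : g S Y = n - Y.1.rank := finrank_dotForm_orthogonal _
  have hle (Y : Matrix (Fin n) (Fin m) F) : Y.rank ≤ n := Y.rank_le_height
  have hmem (S : Submodule F (Fin n → F)) (hS : finrank F S = s) (Y : D S) : g S Y ∈ insert n I := by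
    rw [hg, Finset.mem_insert]
    by_cases hY : Y.1.rank = 0
    · left; omega
    · right
      refine Finset.mem_image_of_mem _ (hfin.mem_toFinset.mpr ⟨⟨Y.1, Y.2.1, rfl⟩, by omega, ?_⟩)
      rw [← hS, ← finrank_dotForm_orthogonal]
      exact Submodule.finrank_mono Y.2.2
  have hzero (S) : Nat.card {Y : D S // g S Y = n} = 1 := by
    rw [Nat.card_eq_one_iff_unique]
    have hz (Y : {Y : D S // g S Y = n}) : Y.1.1 = 0 := eq_zero_of_rank_eq_zero (by
      have h1 := Y.2
      rw [hg] at h1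
      have := hle Y.1.1
      by_cases hn : n = 0 <;> omega)
    refine ⟨⟨fun A B => Subtype.ext (Subtype.ext ((hz A).trans (hz B).symm))⟩,
      ⟨⟨0, zero_mem _, mem_matricesWithin_iff.mp (zero_mem _)⟩, ?_⟩⟩
    rw [hg]
    simp
  have hcard (S V : Submodule F (Fin n → F)) :
      Nat.card {Y : D S // V ≤ (dotForm F n).orthogonal (colSpace Y.1)}
        = Nat.card {Y // Y ∈ dualCode C ∧ colSpace Y ≤ (dotForm F n).orthogonal (S ⊔ V)} := by
    refine Nat.card_congr ((Equiv.subtypeSubtypeEquivSubtypeInter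
      (fun Y => Y ∈ dualCode C ∧ colSpace Y ≤ (dotForm F n).orthogonal S)
      (fun Y => V ≤ (dotForm F n).orthogonal (colSpace Y))).trans
      (Equiv.subtypeEquivRight fun Y => ?_))
    rw [le_dotForm_orthogonal_sup, le_dotForm_orthogonal_comm (U := V), and_assoc]
  have hnI : n ∉ I := fun h => by
    obtain ⟨w, hw, hwn⟩ := Finset.mem_image.mp h
    have : 1 ≤ w ∧ w ≤ n - s := (hfin.mem_toFinset.mp hw).2
    have : n - w = n := hwn
    omega
  obtain ⟨e, he⟩ := exists_equiv_comp_eq_of_sum_pow (Finite.one_lt_card (α := F)) I n hnI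
    (g S) (g S') (hmem S hS) (hmem S' hS') ((hzero S).trans (hzero S').symm) fun j hj => by
      rw [sum_card_pow_finrank (fun Y : D S => (dotForm F n).orthogonal (colSpace Y.1)),
        sum_card_pow_finrank (fun Y : D S' => (dotForm F n).orthogonal (colSpace Y.1))]
      -- Pairing x with f ∘ x preserves dim(S ⊔ span x), which is at most s + j < d since j < |I| ≤
      -- d - s.
      obtain ⟨f, hf⟩ := exists_linearEquiv_map_eq rfl S S' (hS.trans hS'.symm)
      refine Fintype.sum_equiv (Equiv.piCongrRight fun _ => f.toEquiv) _ _ fun x => ?_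
      have hspan : span F (Set.range (Equiv.piCongrRight (fun _ : Fin j => f.toEquiv) x))
          = (span F (Set.range x)).map (f : (Fin n → F) →ₗ[F] (Fin n → F)) := by
        rw [Submodule.map_span, ← Set.range_comp]
        rfl
      rw [hcard, hcard, hspan, ← hf, ← Submodule.map_sup]
      refine card_dualCode_within_eq hd (LinearEquiv.finrank_map_eq _ _).symm ?_
      have h1 := Submodule.finrank_add_le_finrank_add_finrank S (span F (Set.range x))
      have h2 := (finrank_range_le_card (R := F) x).trans_eq (Fintype.card_fin j)
      change finrank F (span F (Set.range x)) ≤ j at h2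
      omega
  refine ⟨e, fun Y => ?_⟩
  have h1 := he Y
  rw [hg, hg] at h1
  have h2 := hle Y.1
  have h3 := hle (e Y).1
  omega

/-- The rank distribution of the puncturing of `C` at `S` is determined by that of the shortening of
the dual code at `S`. -/
theorem card_finrank_colSpace_sup_eq (C : Submodule F (Matrix (Fin n) (Fin m) F))
    {S S' : Submodule F (Fin n → F)} (hS : finrank F S = finrank F S')
    (e : {Y // Y ∈ dualCode C ∧ colSpace Y ≤ (dotForm F n).orthogonal S} ≃
        {Y // Y ∈ dualCode C ∧ colSpace Y ≤ (dotForm F n).orthogonal S'})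
    (he : ∀ Y, (e Y).1.rank = Y.1.rank) (j : ℕ) :
    Nat.card {A : C // finrank F ↥(colSpace A.1 ⊔ S) = j}
      = Nat.card {A : C // finrank F ↥(colSpace A.1 ⊔ S') = j} := by
  classical
  have := Fintype.ofFinite C
  let H (S : Submodule F (Fin n → F)) := (dotForm F n).orthogonal S
  let D (S : Submodule F (Fin n → F)) : Type _ := {Y // Y ∈ dualCode C ∧ colSpace Y ≤ H S}
  have hDfin (S) : Fintype (D S) := Fintype.ofFinite _
  have hFfin (j : ℕ) (S) : Fintype (Fin j → H S) := Fintype.ofFinite _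
  -- This is (col A ⊔ S)^⊥ seen inside S^⊥, so that only tuples in S^⊥ are counted.
  let U (S) (A : C) : Submodule F (H S) := (H (colSpace A.1)).comap (H S).subtype
  have hU (S) (A : C) : finrank F (U S A) = n - finrank F ↥(colSpace A.1 ⊔ S) := by
    have h : H S ⊓ H (colSpace A.1) = (dotForm F n).orthogonal (colSpace A.1 ⊔ S) := by
      refine le_antisymm (le_dotForm_orthogonal_sup.mpr ⟨inf_le_right, inf_le_left⟩) ?_
      exact le_inf (le_dotForm_orthogonal_sup.mp le_rfl).2 (le_dotForm_orthogonal_sup.mp le_rfl).1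
    rw [← finrank_dotForm_orthogonal, ← Submodule.finrank_map_subtype_eq,
      Submodule.map_comap_subtype, h]
  -- The MacWilliams factor for V = R^⊥ with dim R = r.
  let c (r : ℕ) : ℕ := Nat.card C * Nat.card F ^ (m * (n - r))
  have hcount (S) (R : Submodule F (H S)) :
      Nat.card {A // R ≤ U S A} * Nat.card F ^ (m * n)
        = ∑ Y : D S, if (colSpace Y.1).comap (H S).subtype ≤ R then c (finrank F R) else 0 := by
    have h1 : Nat.card {A // R ≤ U S A}
        = Nat.card {A // A ∈ C ∧ colSpace A ≤ H (R.map (H S).subtype)} :=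
      Nat.card_congr ((Equiv.subtypeSubtypeEquivSubtypeInter (fun A => A ∈ C)
        (fun A => R ≤ (H (colSpace A)).comap (H S).subtype)).trans
        (Equiv.subtypeEquivRight fun A => by
          rw [← Submodule.map_le_iff_le_comap, le_dotForm_orthogonal_comm]))
    have h2 : Nat.card {Y // Y ∈ dualCode C ∧ colSpace Y ≤ H (H (R.map (H S).subtype))}
        = Nat.card {Y : D S // (colSpace Y.1).comap (H S).subtype ≤ R} := by
      refine (Nat.card_congr ((Equiv.subtypeSubtypeEquivSubtypeInter
        (fun Y => Y ∈ dualCode C ∧ colSpace Y ≤ H S)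
        (fun Y => (colSpace Y).comap (H S).subtype ≤ R)).trans
        (Equiv.subtypeEquivRight fun Y => ?_))).symm
      rw [show H (H (R.map (H S).subtype)) = R.map (H S).subtype from
        LinearMap.BilinForm.orthogonal_orthogonal dotForm_nondegenerate dotForm_isSymm.isRefl _,
        and_assoc]
      refine and_congr_right fun _ => ⟨fun h x hx => ?_, fun h => ⟨?_, fun x hx => ?_⟩⟩
      · exact ⟨⟨x, h.1 hx⟩, h.2 hx, rfl⟩
      · exact h.trans (Submodule.map_subtype_le _ _)
      · obtain ⟨y, hy, hyx⟩ := h hx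
        rwa [← Subtype.ext hyx]
    rw [h1, ← card_dualCode_within_mul C, h2, ← Finset.sum_filter, Finset.sum_const, smul_eq_mul,
      finrank_dotForm_orthogonal, Submodule.finrank_map_subtype_eq, Nat.card_eq_fintype_card,
      Fintype.card_subtype]
  have hmom (j : ℕ) : ∑ A, Nat.card F ^ (j * finrank F (U S A))
      = ∑ A, Nat.card F ^ (j * finrank F (U S' A)) := by
    refine Nat.eq_of_mul_eq_mul_right (pow_pos (Nat.card_pos (α := F)) (m * n)) ?_
    rw [sum_card_pow_finrank, sum_card_pow_finrank, Finset.sum_mul, Finset.sum_mul]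
    simp only [hcount]
    -- With Y outermost, the sum over tuples depends only on rank Y and dim S^⊥, so `e` matches the
    -- terms.
    refine Finset.sum_comm.trans (Eq.trans ?_ Finset.sum_comm)
    refine Fintype.sum_equiv e _ _ fun Y => sum_ite_le_span_eq ?_ _ _ ?_ j c
    · rw [finrank_dotForm_orthogonal, finrank_dotForm_orthogonal, hS]
    · rw [← Submodule.finrank_map_subtype_eq, ← Submodule.finrank_map_subtype_eq (H S'),
        Submodule.map_comap_subtype, Submodule.map_comap_subtype, inf_eq_right.mpr Y.2.2,
        inf_eq_right.mpr (e Y).2.2]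
      exact (he Y).symm
  -- All moments are known, so no fibre is needed in advance: n + 1 is a dummy value that is never
  -- attained.
  have hmem (S) (A : C) : finrank F (U S A) ∈ insert (n + 1) (Finset.range (n + 1)) := by
    rw [hU, Finset.mem_insert, Finset.mem_range]
    omega
  have hemp (S) : IsEmpty {A : C // finrank F (U S A) = n + 1} :=
    ⟨fun A => by
      have := A.2
      rw [hU] at this
      omega⟩
  obtain ⟨f, hf⟩ := exists_equiv_comp_eq_of_sum_pow (Finite.one_lt_card (α := F))
    (Finset.range (n + 1)) (n + 1) (by simp) (fun A : C => finrank F (U S A))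
    (fun A : C => finrank F (U S' A)) (hmem S) (hmem S')
    (by have := hemp S; have := hemp S'; simp) (fun j _ => hmom j)
  refine Nat.card_congr (f.subtypeEquiv fun A => ?_)
  have h1 := hf A
  rw [hU, hU] at h1
  have h2 := Submodule.finrank_le (colSpace A.1 ⊔ S)
  have h3 := Submodule.finrank_le (colSpace (f A).1 ⊔ S')
  rw [finrank_fin_fun] at h2 h3
  omega

/-! ### Block weights and the design property. -/

/-- The weights of the blocks of dimension `i` above `T` add up to the number of the codewords of
rank `i` whose column space contains `T`. -/
theorem finsum_supportBlocks_eq {b : LinearMap.BilinForm F (Fin n → F)} (hb : b.Nondegenerate)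
    (hsymm : b.IsSymm) (C : Submodule F (Matrix (Fin n) (Fin m) F)) (i : ℕ)
    (T : Submodule F (Fin n → F)) :
    ∑ᶠ (B : supportBlocks b C i) (_ : T ≤ (B : Submodule F (Fin n → F))),
        ((codewordsEq b C (b.orthogonal (B : Submodule F (Fin n → F)))).ncard : ℤ)
      = Nat.card {A : C // finrank F (colSpace A.1) = i ∧
          finrank F ↥(colSpace A.1 ⊓ T) = finrank F T} := by
  classical
  have := Fintype.ofFinite (Submodule F (Fin n → F))
  have hcw (V : Submodule F (Fin n → F)) : (codewordsEq b C (b.orthogonal V)).ncard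
      = Nat.card {A : C // colSpace A.1 = V} := by
    rw [← Nat.card_coe_set_eq]
    refine (Nat.card_congr ((Equiv.subtypeSubtypeEquivSubtypeInter (fun A => A ∈ C)
        (fun A => colSpace A = V)).trans (Equiv.subtypeEquivRight fun A => ?_))).symm
    rw [codewordsEq, LinearMap.BilinForm.orthogonal_orthogonal hb hsymm.isRefl]
    rfl
  rw [finsum_set_coe_eq_finsum_mem (supportBlocks b C i)
      (f := fun B : Submodule F (Fin n → F) => ∑ᶠ _ : T ≤ B,
        ((codewordsEq b C (b.orthogonal B)).ncard : ℤ)),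
    card_subtype_eq_sum_fiber _ (fun A : C => colSpace A.1) Finset.univ (fun _ _ => Finset.mem_univ _),
    finsum_eq_sum_of_fintype, Nat.cast_sum]
  refine Finset.sum_congr rfl fun V _ => ?_
  rw [finsum_eq_if, finsum_eq_if, supportBlocks, Set.mem_ofPred_eq, hcw]
  by_cases hV : finrank F V = i ∧ T ≤ V
  · have : Nat.card {A : C // (finrank F (colSpace A.1) = i ∧
        finrank F ↥(colSpace A.1 ⊓ T) = finrank F T) ∧ colSpace A.1 = V}
        = Nat.card {A : C // colSpace A.1 = V} :=
      Nat.card_congr (Equiv.subtypeEquivRight fun A => ⟨fun h => h.2, fun h => by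
        rw [h, inf_eq_right.mpr hV.2]
        exact ⟨⟨hV.1, rfl⟩, rfl⟩⟩)
    rw [this, if_pos hV.2]
    -- Outside the block set the count is zero, so omitting such V loses nothing.
    split_ifs with h
    · rfl
    · by_contra h0
      exact h ⟨hV.1, fun h1 => h0 (by rw [h1]; rfl)⟩
  · have hemp : IsEmpty {A : C // (finrank F (colSpace A.1) = i ∧
        finrank F ↥(colSpace A.1 ⊓ T) = finrank F T) ∧ colSpace A.1 = V} :=
      ⟨fun A => hV (by
        obtain ⟨A, ⟨h1, h2⟩, rfl⟩ := A
        exact ⟨h1, inf_eq_right.mp (Submodule.eq_of_le_of_finrank_eq inf_le_right h2)⟩)⟩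
    rw [@Nat.card_of_isEmpty _ hemp]
    split_ifs with h1 h2
    · exact absurd ⟨h1.1, h2⟩ hV
    · rfl
    · rfl

end

/-- Passing to a smaller dimension `s ≤ t` preserves the bound on the number of dual ranks. -/
theorem ncard_inter_Icc_le_of_le {W : Set ℕ} {n d s t : ℕ} (hst : s ≤ t) (htd : t ≤ d)
    (hw : (W ∩ Set.Icc 1 (n - t)).ncard ≤ d - t) :
    (W ∩ Set.Icc 1 (n - s)).ncard ≤ d - s := by
  -- Lowering t to s adds at most t - s possible ranks and raises the allowance by exactly t - s.
  have hsub : W ∩ Set.Icc 1 (n - s)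
      ⊆ (W ∩ Set.Icc 1 (n - t)) ∪ (Finset.Icc (n - t + 1) (n - s) : Finset ℕ) := by
    rintro w ⟨hwW, h1, h2⟩
    by_cases h : w ≤ n - t
    · exact Or.inl ⟨hwW, h1, h⟩
    · exact Or.inr (by rw [Finset.coe_Icc]; exact ⟨by omega, h2⟩)
  have h1 := Set.ncard_le_ncard hsub
    (((Set.finite_Icc 1 (n - t)).inter_of_right _).union (Finset.finite_toSet _))
  have h2 := Set.ncard_union_le (W ∩ Set.Icc 1 (n - t))
    (Finset.Icc (n - t + 1) (n - s) : Finset ℕ)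
  rw [Set.ncard_coe_finset, Nat.card_Icc] at h2
  omega

theorem corollary5p8 {F : Type*} [Field F] [Finite F] {n m k d t : ℕ}
    (b : LinearMap.BilinForm F (Fin n → F)) (hb : b.Nondegenerate) (hsymm : b.IsSymm)
    (C : Submodule F (Matrix (Fin n) (Fin m) F)) (hC : IsRankMetricCode C k d)
    (ht : 0 < t) (htd : t < d)
    (hw : (rankWeights (dualCode C) ∩ Set.Icc 1 (n - t)).ncard ≤ d - t) :
    ∀ i ∈ Set.Icc d (n - t), ∃ lam : ℤ,
      IsWeightedSubspaceDesign F t i lam (supportBlocks b C i)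
        (fun X => ((codewordsEq b C (b.orthogonal (X : Submodule F (Fin n → F)))).ncard : ℤ)) := by
  intro i hi
  have hd : ∀ A ∈ C, A ≠ 0 → d ≤ A.rank := fun A hA h0 =>
    hC.isLeast_rank.2 ⟨A, hA, h0, rfl⟩
  have hconst (T T' : Submodule F (Fin n → F)) (hT : Module.finrank F T = t)
      (hT' : Module.finrank F T' = t) :=
    card_finrank_inf_eq (fun A : C => colSpace A.1) t (fun S S' hS hSt j => by
      obtain ⟨e, he⟩ := exists_equiv_dualCode_within_rank_eq hd
        (ncard_inter_Icc_le_of_le hSt htd.le hw) rfl hS.symm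
      exact card_finrank_colSpace_sup_eq C hS e he j) t le_rfl i T T' hT hT' t
  by_cases h : ∃ T₀ : Submodule F (Fin n → F), Module.finrank F T₀ = t
  · obtain ⟨T₀, hT₀⟩ := h
    refine ⟨(Nat.card {A : C // Module.finrank F (colSpace A.1) = i ∧
      Module.finrank F ↥(colSpace A.1 ⊓ T₀) = t} : ℤ), ht,
      ht.trans (htd.trans_le hi.1), fun B hB => hB.1, fun T hT => ?_⟩
    rw [finsum_supportBlocks_eq hb hsymm, hT, hconst T T₀ hT hT₀]
  -- With no t-dimensional T, any λ serves.
  · exact ⟨0, ht, ht.trans (htd.trans_le hi.1), fun B hB => hB.1, fun T hT => (h ⟨T, hT⟩).elim⟩
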